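/- Let $\omega \in S_n$ be vexillary, i.e. $2143$-avoiding. Let $r_i$ be the minimum number of entries that must be removed from $\omega(i), \omega(i+1), \ldots, \omega(n)$ to leave an increasing sequence beginning with $\omega(i)$ (Rajchgot code), and let $c_i = |\{j : i<j,\ \omega(i)>\omega(j)\}|$ (Lehmer code). For $i \in [n]$ let $\mathrm{rank}_\omega(i)$ be the length of a longest increasing subsequence of $\omega$ all of whose positions $j$ satisfy $j \le \omega^{-1}(i)$ and $\omega(j) \le i$. Let $P_R(\omega)$ be the Rothe bumpless pipe dream of $\omega$, i.e. the unique bumpless pipe dream of size $n \times n$ that has a down-elbow (joining the bottom and right edges of its square) in each square $(i,\omega(i))$ and has no up-elbows (joining the left and top edges). Label each blank tile $(i,j)$ of $P_R(\omega)$ with $r(i,j) = |\{k : k<i,\ \omega(k)<j\}|$. Then there is a unique Young diagram $\lambda(\omega)$ having, on each northwest-southeast diagonal $\{(i,j): j-i=d\}$, $d \in \mathbb{Z}$, the same number of tiles as there are blank tiles of $P_R(\omega)$ on that diagonal. Fill the $m$-th tile of $\lambda(\omega)$ on each diagonal (counted from the northwest) with the label of the $m$-th blank tile of $P_R(\omega)$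 on the same diagonal, and let $\tau_k(\omega)$ be the set of tiles of $\lambda(\omega)$ filled with values $\ge k$. For a finite set $S$ of squares let $\rho_a(S)$ be the maximal length $l$ of an antidiagonal path in $S$, i.e. of a subset $\{(i_1,j_1),\ldots,(i_l,j_l)\} \subseteq S$ with $i_1>\cdots>i_l$ and $j_1<\cdots<j_l$. Then for every integer $k \ge 1$, $$\sum_{\{i\,:\,\mathrm{rank}_\omega(i)=k\}} \bigl(r_{\omega^{-1}(i)} - c_{\omega^{-1}(i)}\bigr) = \rho_a(\tau_k(\omega)).$$ -/

import Mathlib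

namespace Vexillary

/-- Permutations of `[n]` are elements of `Equiv.Perm (Fin n)`; rows, columns, positions and values
are numbered from `0`. A permutation is vexillary if it avoids the pattern `2143`. -/
def IsVexillary {n : ℕ} (w : Equiv.Perm (Fin n)) : Prop :=
  ¬ ∃ a b c d : Fin n, a < b ∧ b < c ∧ c < d ∧ w b < w a ∧ w a < w d ∧ w d < w c

/-! ### Bumpless pipe dreams -/

/-- The six tiles of a bumpless pipe dream. An up-elbow joins the left and the top edge of its
square, a down-elbow joins the bottom and the right edge. -/
inductive Tile : Type
  | cross
  | vertical
  | horizontal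
  | upElbow
  | downElbow
  | blank
  deriving DecidableEq

namespace Tile

/-- The tile has a pipe through its top edge. -/
def top : Tile → Bool
  | cross => true
  | vertical => true
  | upElbow => true
  | _ => false

/-- The tile has a pipe through its bottom edge. -/
def bottom : Tile → Bool
  | cross => true
  | vertical => true
  | downElbow => true
  | _ => false

/-- The tile has a pipe through its left edge. -/
def left : Tile → Bool
  | cross => true
  | horizontal => true
  | upElbow => true
  | _ => false

/-- The tile has a pipe through its right edge. -/
def right : Tile → Bool
  | cross => true
  | horizontal => true
  | downElbow => true
  | _ => false

end Tile

/-- A tiling of the `n × n` grid (`P i j` is the tile in row `i`, counted from the top, and column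
`j`) is a bumpless pipe dream if adjacent tiles fit together, a pipe enters at every bottom edge of
the grid and leaves at every right edge, and none meets the top or the left side of the grid. -/
structure IsBPD {n : ℕ} (P : Fin n → Fin n → Tile) : Prop where
  vert : ∀ i i' j : Fin n, (i' : ℕ) = i + 1 → (P i j).bottom = (P i' j).top
  horiz : ∀ i j j' : Fin n, (j' : ℕ) = j + 1 → (P i j).right = (P i j').left
  top_side : ∀ i j : Fin n, (i : ℕ) = 0 → (P i j).top = false
  left_side : ∀ i j : Fin n, (j : ℕ) = 0 → (P i j).left = false
  bottom_side : ∀ i j : Fin n, (i : ℕ) + 1 = n → (P i j).bottom = true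
  right_side : ∀ i j : Fin n, (j : ℕ) + 1 = n → (P i j).right = true

/-- The Rothe bumpless pipe dream `P_R(w)`: in each row `i` there is a down-elbow in column `w i`,
with a pipe running to the right and down from it. See `rotheBPD_spec` for its characterization. -/
def rotheBPD {n : ℕ} (w : Equiv.Perm (Fin n)) (i j : Fin n) : Tile :=
  if w i = j then Tile.downElbow
  else if w i < j then (if w.symm j < i then Tile.cross else Tile.horizontal)
  else (if w.symm j < i then Tile.vertical else Tile.blank)

theorem rotheBPD_left {n : ℕ} (w : Equiv.Perm (Fin n)) (i j : Fin n) :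
    (rotheBPD w i j).left = decide (w i < j) := by
  unfold rotheBPD
  by_cases h : w i = j
  · simp [h, Tile.left]
  · by_cases h1 : w i < j <;> by_cases h2 : w.symm j < i <;> simp [h, h1, h2, Tile.left]

theorem rotheBPD_right {n : ℕ} (w : Equiv.Perm (Fin n)) (i j : Fin n) :
    (rotheBPD w i j).right = decide (w i ≤ j) := by
  unfold rotheBPD
  by_cases h : w i = j
  · simp [h, Tile.right]
  · by_cases h1 : w i < j <;> by_cases h2 : w.symm j < i <;>
      simp [h, h1, h2, Tile.right, le_iff_lt_or_eq]

theorem rotheBPD_top {n : ℕ} (w : Equiv.Perm (Fin n)) (i j : Fin n) :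
    (rotheBPD w i j).top = decide (w.symm j < i) := by
  unfold rotheBPD
  by_cases h : w i = j
  · subst h; simp [Tile.top]
  · by_cases h1 : w i < j <;> by_cases h2 : w.symm j < i <;> simp [h, h1, h2, Tile.top]

theorem rotheBPD_bottom {n : ℕ} (w : Equiv.Perm (Fin n)) (i j : Fin n) :
    (rotheBPD w i j).bottom = decide (w.symm j ≤ i) := by
  unfold rotheBPD
  by_cases h : w i = j
  · subst h; simp [Tile.bottom]
  · have h' : w.symm j ≠ i := fun e => h (by rw [← e]; simp)
    by_cases h1 : w i < j <;> by_cases h2 : w.symm j < i <;>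
      simp [h, h', h1, h2, Tile.bottom, le_iff_lt_or_eq]

/-- `rotheBPD w` is the unique bumpless pipe dream with down-elbows in all squares `(i, w i)` and
without up-elbows. -/
theorem rotheBPD_spec {n : ℕ} (w : Equiv.Perm (Fin n)) (P : Fin n → Fin n → Tile) :
    (IsBPD P ∧ (∀ i, P i (w i) = Tile.downElbow) ∧ ∀ i j, P i j ≠ Tile.upElbow) ↔
      P = rotheBPD w := by
  constructor
  · rintro ⟨hP, hd, hu⟩
    have hrow : ∀ (i j : Fin n) (m : ℕ) (j' : Fin n), (j' : ℕ) = j + 1 + m →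
        (P i j).right = true → (P i j').left = true := by
      intro i j m
      induction m with
      | zero => intro j' h hr; rw [← hP.horiz i j j' (by simpa using h)]; exact hr
      | succ m ih =>
        intro j' h hr
        have hlt : (j : ℕ) + 1 + m < n := by have := j'.isLt; omega
        have h1 := ih ⟨j + 1 + m, hlt⟩ rfl hr
        rw [← hP.horiz i ⟨j + 1 + m, hlt⟩ j' (by simp; omega)]
        have h2 := hu i ⟨j + 1 + m, hlt⟩
        revert h1 h2
        cases P i ⟨j + 1 + m, hlt⟩ <;> simp [Tile.left, Tile.right]
    have hcol : ∀ (i j : Fin n) (m : ℕ) (i' : Fin n), (i' : ℕ) = i + 1 + m →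
        (P i j).bottom = true → (P i' j).top = true := by
      intro i j m
      induction m with
      | zero => intro i' h hr; rw [← hP.vert i i' j (by simpa using h)]; exact hr
      | succ m ih =>
        intro i' h hr
        have hlt : (i : ℕ) + 1 + m < n := by have := i'.isLt; omega
        have h1 := ih ⟨i + 1 + m, hlt⟩ rfl hr
        rw [← hP.vert ⟨i + 1 + m, hlt⟩ i' j (by simp; omega)]
        have h2 := hu ⟨i + 1 + m, hlt⟩ j
        revert h1 h2
        cases P ⟨i + 1 + m, hlt⟩ j <;> simp [Tile.top, Tile.bottom]
    funext i j
    by_cases hij : w i = j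
    · subst hij; rw [hd]; simp [rotheBPD]
    have hij' : w.symm j ≠ i := fun e => hij (by rw [← e]; simp)
    have hu' := hu i j
    have hl : w i < j → (P i j).left = true := fun h =>
      hrow i (w i) (j - w i - 1) j (by have : (w i : ℕ) < j := h; omega)
        (by rw [hd]; rfl)
    have hr : ¬ w i < j → (P i j).right = false := by
      intro h
      have hlt : (j : ℕ) < w i := lt_of_le_of_ne (not_lt.1 h) (fun e => hij (Fin.ext e.symm))
      by_contra hc
      have := hrow i j (w i - j - 1) (w i) (by omega) (by simpa using hc)
      rw [hd] at this
      simp [Tile.left] at this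
    have hdj : P (w.symm j) j = Tile.downElbow := by simpa using hd (w.symm j)
    have ht : w.symm j < i → (P i j).top = true := fun h =>
      hcol (w.symm j) j (i - w.symm j - 1) i (by have : (w.symm j : ℕ) < i := h; omega)
        (by rw [hdj]; rfl)
    have hb : ¬ w.symm j < i → (P i j).bottom = false := by
      intro h
      have hlt : (i : ℕ) < w.symm j :=
        lt_of_le_of_ne (not_lt.1 h) (fun e => hij' (Fin.ext e.symm))
      by_contra hc
      have := hcol i j (w.symm j - i - 1) (w.symm j) (by omega) (by simpa using hc)
      rw [hdj] at this
      simp [Tile.top] at this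
    unfold rotheBPD
    by_cases h1 : w i < j <;> by_cases h2 : w.symm j < i <;>
      simp only [h1, h2, hij, if_true, if_false, not_true_eq_false, not_false_eq_true,
        forall_true_left, false_imp_iff] at hl hr ht hb ⊢ <;>
      revert hu' hl hr ht hb <;>
      cases P i j <;> simp [Tile.left, Tile.right, Tile.top, Tile.bottom]
  · rintro rfl
    refine ⟨⟨?_, ?_, ?_, ?_, ?_, ?_⟩, ?_, ?_⟩
    · intro i i' j h
      rw [rotheBPD_bottom, rotheBPD_top]
      congr 1
      simp only [Fin.le_def, Fin.lt_def, eq_iff_iff]; omega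
    · intro i j j' h
      rw [rotheBPD_right, rotheBPD_left]
      congr 1
      simp only [Fin.le_def, Fin.lt_def, eq_iff_iff]; omega
    · intro i j h
      rw [rotheBPD_top]; simp only [Fin.lt_def, decide_eq_false_iff_not]; omega
    · intro i j h
      rw [rotheBPD_left]; simp only [Fin.lt_def, decide_eq_false_iff_not]; omega
    · intro i j h
      rw [rotheBPD_bottom]; simp only [Fin.le_def, decide_eq_true_eq]
      have := (w.symm j).isLt; omega
    · intro i j h
      rw [rotheBPD_right]; simp only [Fin.le_def, decide_eq_true_eq]
      have := (w i).isLt; omega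
    · intro i; simp [rotheBPD]
    · intro i j
      unfold rotheBPD
      split_ifs <;> simp

/-- The set `D(P_R(w))` of blank tiles of the Rothe bumpless pipe dream, as pairs (row, column). -/
def blankTiles {n : ℕ} (w : Equiv.Perm (Fin n)) : Finset (ℕ × ℕ) :=
  (Finset.univ.filter fun p : Fin n × Fin n => rotheBPD w p.1 p.2 = Tile.blank).image
    fun p => ((p.1 : ℕ), (p.2 : ℕ))

/-- The label `r(i, j)`: the number of squares `(k, w k)` with `k < i` and `w k < j`. -/
def label {n : ℕ} (w : Equiv.Perm (Fin n)) (p : ℕ × ℕ) : ℕ :=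
  (Finset.univ.filter fun k : Fin n => (k : ℕ) < p.1 ∧ (w k : ℕ) < p.2).card

/-! ### The filled Young diagram -/

/-- The index of the (northwest to southeast) diagonal on which a square lies. -/
def diag (p : ℕ × ℕ) : ℤ := (p.2 : ℤ) - (p.1 : ℤ)

/-- `lam` has as many tiles in each diagonal as `D(P_R(w))` has in the corresponding diagonal. -/
def IsShape {n : ℕ} (w : Equiv.Perm (Fin n)) (lam : YoungDiagram) : Prop :=
  ∀ d : ℤ, (lam.cells.filter fun p => diag p = d).card =
    ((blankTiles w).filter fun p => diag p = d).card

/-- The number of squares of `S` strictly before `p` (to the northwest) on the diagonal of `p`. -/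
def diagPos (S : Finset (ℕ × ℕ)) (p : ℕ × ℕ) : ℕ :=
  (S.filter fun q => diag q = diag p ∧ q.1 < p.1).card

/-- The tile `p` of `lam` corresponds to the blank tile `q` of `P_R(w)`: for some `m` and some
diagonal, both are the `m`-th tile on that diagonal, counted from the northwest. -/
def Corresponds {n : ℕ} (w : Equiv.Perm (Fin n)) (lam : YoungDiagram) (p q : ℕ × ℕ) : Prop :=
  diag p = diag q ∧ diagPos lam.cells p = diagPos (blankTiles w) q

open Classical in
/-- `τ_k(w)`: each tile of `lam` is filled with the label of the corresponding blank tile of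
`P_R(w)`; keep the tiles filled with a value at least `k`. -/
noncomputable def tau {n : ℕ} (w : Equiv.Perm (Fin n)) (lam : YoungDiagram) (k : ℕ) :
    Finset (ℕ × ℕ) :=
  lam.cells.filter fun p => ∃ q ∈ blankTiles w, Corresponds w lam p q ∧ k ≤ label w q

/-- An antidiagonal path: a set of squares that can be listed with strictly decreasing rows and
strictly increasing columns. -/
def IsAntidiagonalPath (T : Finset (ℕ × ℕ)) : Prop :=
  ∀ p ∈ T, ∀ q ∈ T, p ≠ q → (q.1 < p.1 ∧ p.2 < q.2) ∨ (p.1 < q.1 ∧ q.2 < p.2)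

open Classical in
/-- `ρ_a(S)`: the number of squares of a longest antidiagonal path contained in `S`. -/
noncomputable def rhoA (S : Finset (ℕ × ℕ)) : ℕ :=
  (S.powerset.filter IsAntidiagonalPath).sup Finset.card

/-! ### Codes and rank -/

/-- The entry `r_i` of the Rajchgot code: the minimum number of entries that must be removed from
`w i, w (i + 1), …` to leave an increasing sequence beginning with `w i`. -/
noncomputable def rajchgot {n : ℕ} (w : Equiv.Perm (Fin n)) (i : Fin n) : ℕ :=
  sInf {m : ℕ | ∃ R : Finset (Fin n), R ⊆ Finset.Ioi i ∧ R.card = m ∧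
    StrictMonoOn w (↑(Finset.Ici i \ R) : Set (Fin n))}

/-- The entry `c_i` of the Lehmer code. -/
def lehmer {n : ℕ} (w : Equiv.Perm (Fin n)) (i : Fin n) : ℕ :=
  (Finset.univ.filter fun j : Fin n => i < j ∧ w j < w i).card

open Classical in
/-- The rank of pipe `i`, i.e. of the value `i` in position `w⁻¹ i`: the length of a longest
increasing subsequence of `w` whose positions `j` satisfy `j ≤ w⁻¹ i` and `w j ≤ i`. -/
noncomputable def pipeRank {n : ℕ} (w : Equiv.Perm (Fin n)) (i : Fin n) : ℕ :=
  ((Finset.univ.filter fun j : Fin n => j ≤ w.symm i ∧ w j ≤ i).powerset.filter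
    fun T : Finset (Fin n) => StrictMonoOn w (T : Set (Fin n))).sup Finset.card

end Vexillary

namespace Vexillary

open Finset

variable {n : ℕ}

/-! Avoiding 2143 means that at every vertex of the grid the dots to the northwest or the dots to
the southeast increase (`IsVexillary.nwChain_or_seChain`); at a blank tile it is the northwest ones.
Along a diagonal, while the northwest dots increase, each step either leaves a blank tile and keeps
the label, or raises the label by one. So a blank tile with label `r` becomes a tile of the Young
diagram by moving `r` steps northwest along its diagonal (`IsVexillary.isShape_iff`).

For a dot `x`, let `seShape w x` be the shifted blank tiles southeast of `x`. The core is a min-max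
equality: the longest antidiagonal path in `seShape w x` has as many tiles as the fewest dots
southeast of `x` whose removal leaves an increasing sequence. That minimum is `r - c`, since the
dots counted by the Lehmer code must be removed anyway (`IsVexillary.rajchgot_eq`). One inequality
is `IsVexillary.card_chain_add_card_path_le`; the other puts a whole antidiagonal inside the shape
(`IsVexillary.mem_seShape_of_add`).

Finally, `τ_k` is the union of the shapes of the dots of rank `k` (`IsVexillary.tau_eq_biUnion`).
Shapes of distinct dots of equal rank lie strictly southwest-northeast of each other, so their
longest paths concatenate and `ρ_a` is additive. -/

theorem mem_blankTiles (w : Equiv.Perm (Fin n)) (a c : ℕ) :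
    (a, c) ∈ blankTiles w ↔
      ∃ i e : Fin n, (i : ℕ) = a ∧ (w e : ℕ) = c ∧ c < (w i : ℕ) ∧ a < (e : ℕ) := by
  have key : ∀ i j : Fin n, rotheBPD w i j = Tile.blank ↔ j < w i ∧ i < w.symm j := by
    intro i j
    unfold rotheBPD
    by_cases h : w i = j
    · simp [h]
    · have h' : w.symm j ≠ i := fun e => h (by rw [← e]; simp)
      by_cases h1 : w i < j <;> by_cases h2 : w.symm j < i <;> simp [h, h1, h2]
      · exact fun h3 => absurd h3 (not_lt.2 h1.le)
      · exact fun h3 => absurd h3 (not_lt.2 h1.le)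
      · exact fun _ => h2.le
      · exact ⟨lt_of_le_of_ne (not_lt.1 h1) (Ne.symm h), lt_of_le_of_ne (not_lt.1 h2) (Ne.symm h')⟩
  simp only [blankTiles, mem_image, mem_filter, mem_univ, true_and, Prod.exists, key, Prod.mk.injEq]
  constructor
  · rintro ⟨i, j, ⟨h1, h2⟩, rfl, rfl⟩
    exact ⟨i, w.symm j, rfl, by simp, h1, h2⟩
  · rintro ⟨i, e, rfl, rfl, h1, h2⟩
    exact ⟨i, w e, ⟨h1, by simpa using h2⟩, rfl, rfl⟩

/-! ### Increasing quadrants of a vexillary permutation -/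

/-- The dots of `w` strictly northwest of the vertex `(a, c)` form an increasing sequence. -/
def NWChain (w : Equiv.Perm (Fin n)) (a c : ℕ) : Prop :=
  ∀ k l : Fin n, k < l → (l : ℕ) < a → (w k : ℕ) < c → (w l : ℕ) < c → w k < w l

/-- The dots of `w` southeast of the vertex `(a, c)` form an increasing sequence. -/
def SEChain (w : Equiv.Perm (Fin n)) (a c : ℕ) : Prop :=
  ∀ k l : Fin n, k < l → a ≤ (k : ℕ) → c ≤ (w k : ℕ) → c ≤ (w l : ℕ) → w k < w l

theorem NWChain.mono {w : Equiv.Perm (Fin n)} {a c a' c' : ℕ} (h : NWChain w a c)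
    (ha : a' ≤ a) (hc : c' ≤ c) : NWChain w a' c' :=
  fun k l hkl hl h1 h2 => h k l hkl (hl.trans_le ha) (h1.trans_le hc) (h2.trans_le hc)

theorem lt_of_not_lt_of_ne (w : Equiv.Perm (Fin n)) {k l : Fin n} (hkl : k < l)
    (h : ¬ w k < w l) : w l < w k :=
  lt_of_le_of_ne (not_lt.1 h) fun e => hkl.ne' (w.injective e)

theorem IsVexillary.nwChain_or_seChain {w : Equiv.Perm (Fin n)} (hw : IsVexillary w) (a c : ℕ) :
    NWChain w a c ∨ SEChain w a c := by
  by_contra! h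
  obtain ⟨h1, h2⟩ := h
  simp only [NWChain, SEChain] at h1 h2
  push Not at h1 h2
  obtain ⟨k, l, hkl, hl, hk, hl', h⟩ := h1
  obtain ⟨p, q, hpq, hp, hp', hq, h'⟩ := h2
  have e1 := lt_of_not_lt_of_ne w hkl (not_lt.2 h)
  have e2 := lt_of_not_lt_of_ne w hpq (not_lt.2 h')
  exact hw ⟨k, l, p, q, hkl, by omega, hpq, e1, by omega, e2⟩

theorem IsVexillary.nwChain_of_blank {w : Equiv.Perm (Fin n)} (hw : IsVexillary w) {a c : ℕ}
    (h : (a, c) ∈ blankTiles w) : NWChain w (a + 1) (c + 1) := by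
  obtain ⟨i, e, rfl, rfl, h1, h2⟩ := (mem_blankTiles w a c).1 h
  intro k l hkl hl hk hl'
  by_contra hn
  have e1 := lt_of_not_lt_of_ne w hkl hn
  have : l ≠ i := by rintro rfl; omega
  have hli : l < i := by omega
  have : w k ≠ w e := fun h => by have := w.injective h; omega
  exact hw ⟨k, l, i, e, hkl, hli, h2, e1, by omega, h1⟩

/-- A new northwest descent must use row `a` or column `c`, which also belong to the southeast
quadrant at `(a, c)`. It still shares no dot with a descent there, so the two would form a 2143. -/
theorem IsVexillary.seChain_of_not_nwChain_succ {w : Equiv.Perm (Fin n)} (hw : IsVexillary w)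
    {a c : ℕ} (h : NWChain w a c) (h' : ¬ NWChain w (a + 1) (c + 1)) : SEChain w a c := by
  intro p q hpq hp hp' hq
  by_contra hn
  have e2 := lt_of_not_lt_of_ne w hpq hn
  simp only [NWChain] at h'
  push Not at h'
  obtain ⟨k, l, hkl, hl, hk, hl', h3⟩ := h'
  have e1 := lt_of_not_lt_of_ne w hkl (not_lt.2 h3)
  have h4 : ¬ ((l : ℕ) < a ∧ (w k : ℕ) < c) := fun hh =>
    absurd (h k l hkl hh.1 hh.2 (by omega)) (not_lt.2 h3)
  by_cases hla : (l : ℕ) = a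
  · by_cases hkc : (w k : ℕ) = c
    · have hlp : l ≠ p := by rintro rfl; omega
      have hkq : w k ≠ w q := fun hh => by have := w.injective hh; omega
      exact hw ⟨k, l, p, q, hkl, by omega, hpq, e1, by omega, e2⟩
    · have hlp : l ≠ p := by rintro rfl; omega
      exact hw ⟨k, l, p, q, hkl, by omega, hpq, e1, by omega, e2⟩
  · have hkc : (w k : ℕ) = c := by omega
    have hkq : w k ≠ w q := fun hh => by have := w.injective hh; omega
    exact hw ⟨k, l, p, q, hkl, by omega, hpq, e1, by omega, e2⟩

/-! ### Labels and blank tiles along a diagonal -/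

theorem label_succ (w : Equiv.Perm (Fin n)) (i e : Fin n) :
    label w ((i : ℕ) + 1, (w e : ℕ) + 1) = label w ((i : ℕ), (w e : ℕ)) +
      (if w i ≤ w e then 1 else 0) + (if e < i then 1 else 0) := by
  have h1 : (if w i ≤ w e then 1 else 0) =
      ∑ j : Fin n, (if j = i then (if w i ≤ w e then 1 else 0) else 0) := by simp
  have h2 : (if e < i then 1 else 0) =
      ∑ j : Fin n, (if j = e then (if e < i then 1 else 0) else 0) := by simp
  rw [h1, h2]
  simp only [label, card_filter, ← sum_add_distrib]
  refine sum_congr rfl fun j _ => ?_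
  by_cases hi : j = i
  · subst hi
    by_cases he : j = e
    · subst he; simp
    · simp only [he, if_true, if_false]
      split_ifs <;> omega
  · by_cases he : j = e
    · subst he
      have : (j : ℕ) ≠ i := fun h => hi (Fin.ext h)
      simp only [hi, if_true, if_false]
      split_ifs <;> omega
    · have h3 : (j : ℕ) ≠ i := fun h => hi (Fin.ext h)
      have h4 : (w j : ℕ) ≠ w e := fun h => he (w.injective (Fin.ext h))
      simp only [hi, he, if_false]
      split_ifs <;> omega

theorem label_blank {w : Equiv.Perm (Fin n)} {a c : ℕ} (h : (a, c) ∈ blankTiles w) :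
    label w (a + 1, c + 1) = label w (a, c) := by
  obtain ⟨i, e, rfl, rfl, h1, h2⟩ := (mem_blankTiles w a c).1 h
  rw [label_succ, if_neg (by omega), if_neg (by omega), add_zero, add_zero]

/-- The new row and the new column could contribute two distinct dots, but these would form a
descent in the northwest quadrant. -/
theorem label_of_not_blank {w : Equiv.Perm (Fin n)} {a c : ℕ} (ha : a < n) (hc : c < n)
    (hch : NWChain w (a + 1) (c + 1)) (h : (a, c) ∉ blankTiles w) :
    label w (a + 1, c + 1) = label w (a, c) + 1 := by
  obtain ⟨e, he⟩ := w.surjective ⟨c, hc⟩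
  obtain ⟨i, rfl⟩ : ∃ i : Fin n, (i : ℕ) = a := ⟨⟨a, ha⟩, rfl⟩
  obtain rfl : (w e : ℕ) = c := by rw [he]
  have hb : ¬ (w e < w i ∧ i < e) := fun hh =>
    h ((mem_blankTiles w _ _).2 ⟨i, e, rfl, rfl, hh.1, hh.2⟩)
  rw [label_succ]
  by_cases h1 : e < i
  · have h2 : ¬ w i ≤ w e := fun hle => by
      have := hch e i h1 (by omega) (by omega) (by omega)
      omega
    simp [h1, h2]
  · by_cases h3 : e = i
    · subst h3; simp
    · have h2 : w i ≤ w e := by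
        by_contra hlt; exact hb ⟨not_le.1 hlt, by omega⟩
      simp [h1, h2]

theorem card_fin_lt {a : ℕ} (ha : a ≤ n) : #{j : Fin n | (j : ℕ) < a} = a := by
  rw [Fin.card_filter_val_lt, min_eq_right ha]

theorem card_perm_lt (w : Equiv.Perm (Fin n)) (p : ℕ → Prop) [DecidablePred p] :
    #{j : Fin n | p (w j)} = #{j : Fin n | p j} := by
  refine card_bij (fun j _ => w j) (by simp) (fun a _ b _ h => w.injective h) fun b hb => ?_
  exact ⟨w.symm b, by simpa using hb, by simp⟩

theorem label_le_fst {w : Equiv.Perm (Fin n)} {a c : ℕ} (ha : a ≤ n) : label w (a, c) ≤ a := by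
  conv_rhs => rw [← card_fin_lt ha]
  exact card_le_card fun j => by simp +contextual

theorem label_le_snd {w : Equiv.Perm (Fin n)} {a c : ℕ} (hc : c ≤ n) : label w (a, c) ≤ c := by
  conv_rhs => rw [← card_fin_lt hc, ← card_perm_lt w (· < c)]
  exact card_le_card fun j => by simp +contextual

theorem blank_lt {w : Equiv.Perm (Fin n)} {a c : ℕ} (h : (a, c) ∈ blankTiles w) :
    a < n ∧ c < n := by
  obtain ⟨i, e, rfl, rfl, h1, h2⟩ := (mem_blankTiles w a c).1 h
  exact ⟨i.2, (w e).2⟩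

theorem diagPos_succ (S : Finset (ℕ × ℕ)) (a c : ℕ) :
    diagPos S (a + 1, c + 1) = diagPos S (a, c) + if (a, c) ∈ S then 1 else 0 := by
  have h : S.filter (fun q => diag q = diag (a + 1, c + 1) ∧ q.1 < a + 1) =
      S.filter (fun q => diag q = diag (a, c) ∧ q.1 < a) ∪ S.filter (fun q => q = (a, c)) := by
    rw [← filter_or]
    refine filter_congr fun q _ => ?_
    obtain ⟨x, y⟩ := q
    simp only [diag, Prod.mk.injEq]
    omega
  have hd : Disjoint (S.filter (fun q => diag q = diag (a, c) ∧ q.1 < a))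
      (S.filter (fun q => q = (a, c))) := by
    rw [disjoint_filter]
    rintro q _ ⟨_, h1⟩ rfl
    simp at h1
  unfold diagPos
  simp only [] at h ⊢
  rw [h, card_union_of_disjoint hd, filter_eq']
  split_ifs <;> simp

/-- Each of the `min a c` diagonal steps from the border raises exactly one of the two summands by
one. -/
theorem diagPos_add_label {w : Equiv.Perm (Fin n)} (a c : ℕ) (h : NWChain w a c) (ha : a ≤ n)
    (hc : c ≤ n) : diagPos (blankTiles w) (a, c) + label w (a, c) = min a c := by
  induction a generalizing c with
  | zero => simp [diagPos, label]
  | succ a ih =>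
    cases c with
    | zero =>
      have : diagPos (blankTiles w) (a + 1, 0) = 0 := by
        rw [diagPos, card_eq_zero, filter_eq_empty_iff]
        rintro ⟨x, y⟩ _ ⟨h1, h2⟩
        simp only [diag] at h1 h2
        omega
      simp [this, label]
    | succ c =>
      have := ih c (h.mono (by omega) (by omega)) (by omega) (by omega)
      rw [diagPos_succ]
      by_cases hb : (a, c) ∈ blankTiles w
      · rw [label_blank hb, if_pos hb]; omega
      · rw [label_of_not_blank (by omega) (by omega) h hb, if_neg hb]; omega

/-! ### The Young diagram as the shifted blank tiles -/

/-- The tile of the Young diagram that corresponds to a blank tile. -/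
def shift (w : Equiv.Perm (Fin n)) (p : ℕ × ℕ) : ℕ × ℕ := (p.1 - label w p, p.2 - label w p)

theorem IsVexillary.diagPos_blank {w : Equiv.Perm (Fin n)} (hw : IsVexillary w) {p : ℕ × ℕ}
    (h : p ∈ blankTiles w) :
    diagPos (blankTiles w) p + label w p = min p.1 p.2 ∧ label w p ≤ p.1 ∧ label w p ≤ p.2 := by
  obtain ⟨a, c⟩ := p
  have h1 := blank_lt h
  refine ⟨diagPos_add_label a c ((hw.nwChain_of_blank h).mono (by omega) (by omega)) h1.1.le h1.2.le,
    label_le_fst h1.1.le, label_le_snd h1.2.le⟩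

theorem diagPos_lt_card {S : Finset (ℕ × ℕ)} {p : ℕ × ℕ} (hp : p ∈ S) :
    diagPos S p < #{q ∈ S | diag q = diag p} := by
  refine card_lt_card ⟨fun q => by simp +contextual, fun hs => ?_⟩
  have := hs (show p ∈ _ by simp [hp])
  simp at this

theorem diagPos_inj {S : Finset (ℕ × ℕ)} {p q : ℕ × ℕ} (hp : p ∈ S) (hq : q ∈ S)
    (hd : diag p = diag q) (h : diagPos S p = diagPos S q) : p = q := by
  have key : ∀ p ∈ S, ∀ q ∈ S, diag p = diag q → p.1 < q.1 → diagPos S p < diagPos S q := by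
    intro p hp q hq hd h1
    refine card_lt_card ⟨fun x => ?_, fun hs => ?_⟩
    · simp only [mem_filter]
      rintro ⟨h2, h3, h4⟩
      exact ⟨h2, h3.trans hd, h4.trans h1⟩
    · have := hs (show p ∈ _ by simp [hp, hd, h1])
      simp at this
  have h4 : p.1 = q.1 := by
    by_contra hne
    rcases Nat.lt_or_gt_of_ne hne with h1 | h1
    · have := key p hp q hq hd h1; omega
    · have := key q hq p hp hd.symm h1; omega
  simp only [diag] at hd
  exact Prod.ext h4 (by omega)

theorem exists_diagPos_eq (S : Finset (ℕ × ℕ)) (d : ℤ) {m : ℕ} (hm : m < #{q ∈ S | diag q = d}) :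
    ∃ p ∈ S, diag p = d ∧ diagPos S p = m := by
  have hinj : Set.InjOn (diagPos S) ↑(S.filter fun q => diag q = d) := by
    intro p hp q hq he
    rw [mem_coe, mem_filter] at hp hq
    exact diagPos_inj hp.1 hq.1 (hp.2.trans hq.2.symm) he
  have hsub : (S.filter fun q => diag q = d).image (diagPos S) ⊆
      range #{q ∈ S | diag q = d} := by
    intro x hx
    simp only [mem_image, mem_filter] at hx
    obtain ⟨p, ⟨hp, rfl⟩, rfl⟩ := hx
    exact mem_range.2 (diagPos_lt_card hp)
  have heq := eq_of_subset_of_card_le hsub (by rw [card_range, card_image_of_injOn hinj])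
  have := heq ▸ mem_range.2 hm
  simp only [mem_image, mem_filter] at this
  obtain ⟨p, ⟨h1, h2⟩, h3⟩ := this
  exact ⟨p, h1, h2, h3⟩

theorem diagPos_young (lam : YoungDiagram) {p : ℕ × ℕ} (hp : p ∈ lam.cells) :
    diagPos lam.cells p = min p.1 p.2 := by
  obtain ⟨x, y⟩ := p
  have : (lam.cells.filter fun q => diag q = diag (x, y) ∧ q.1 < x) =
      (range (min x y)).image fun t => (x - min x y + t, y - min x y + t) := by
    refine Finset.ext fun ⟨a, b⟩ => ?_
    rw [mem_filter, mem_image]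
    simp only [mem_range, Prod.mk.injEq, diag]
    constructor
    · rintro ⟨h1, h2, h3⟩
      exact ⟨a - (x - min x y), by omega, by omega, by omega⟩
    · rintro ⟨t, h1, rfl, rfl⟩
      refine ⟨?_, by omega, by omega⟩
      exact lam.up_left_mem (by omega) (by omega) hp
  rw [diagPos, this, card_image_of_injOn, card_range]
  intro s _ t _ h
  simp only [Prod.mk.injEq] at h
  omega

/-- Diagonals of a Young diagram have no gaps, so diagonal counts determine it. The shifted blank
tiles obey the same criterion, which gives uniqueness of the shape. -/
theorem mem_young_iff (lam : YoungDiagram) (p : ℕ × ℕ) :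
    p ∈ lam.cells ↔ min p.1 p.2 < #{q ∈ lam.cells | diag q = diag p} := by
  constructor
  · intro h
    rw [← diagPos_young lam h]
    exact diagPos_lt_card h
  · intro h
    obtain ⟨q, hq, hd, hm⟩ := exists_diagPos_eq lam.cells (diag p) h
    rw [diagPos_young lam hq] at hm
    have : q = p := by
      simp only [diag] at hd
      exact Prod.ext (by omega) (by omega)
    exact this ▸ hq

theorem IsVexillary.mem_image_shift {w : Equiv.Perm (Fin n)} (hw : IsVexillary w) (p : ℕ × ℕ) :
    p ∈ (blankTiles w).image (shift w) ↔
      min p.1 p.2 < #{q ∈ blankTiles w | diag q = diag p} := by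
  rw [mem_image]
  constructor
  · rintro ⟨b, hb, rfl⟩
    have h1 := hw.diagPos_blank hb
    have h2 := diagPos_lt_card hb
    have h3 : diag (shift w b) = diag b := by simp only [diag, shift]; omega
    rw [h3]
    simp only [shift]
    omega
  · intro h
    obtain ⟨q, hq, hd, hm⟩ := exists_diagPos_eq _ (diag p) h
    have h1 := hw.diagPos_blank hq
    refine ⟨q, hq, ?_⟩
    simp only [diag] at hd
    exact Prod.ext (by simp only [shift]; omega) (by simp only [shift]; omega)

theorem label_mono (w : Equiv.Perm (Fin n)) {a c a' c' : ℕ} (ha : a ≤ a') (hc : c ≤ c') :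
    label w (a, c) ≤ label w (a', c') :=
  card_le_card fun j => by
    simp only [mem_filter, mem_univ, true_and]
    omega

theorem diagPos_le_card (S : Finset (ℕ × ℕ)) (p : ℕ × ℕ) :
    diagPos S p ≤ #{q ∈ S | diag q = diag p} :=
  card_le_card fun q => by simp +contextual

theorem IsVexillary.isLowerSet_image_shift {w : Equiv.Perm (Fin n)} (hw : IsVexillary w) :
    IsLowerSet (↑((blankTiles w).image (shift w)) : Set (ℕ × ℕ)) := by
  have up : ∀ x y : ℕ, (x + 1, y) ∈ (blankTiles w).image (shift w) →
      (x, y) ∈ (blankTiles w).image (shift w) := by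
    intro x y h
    obtain ⟨⟨i, j⟩, hb, he⟩ := mem_image.1 h
    rw [hw.mem_image_shift]
    have h1 := blank_lt hb
    have h2 := hw.nwChain_of_blank hb
    have h3 := label_blank hb
    simp only [shift, Prod.mk.injEq] at he
    -- The vertex `(i, j + 1)` lies on the diagonal of `(x, y)`, and its label is at most that of
    -- the blank tile `(i, j)`; hence enough blank tiles precede it.
    have h4 := diagPos_add_label i (j + 1) (h2.mono (by omega) le_rfl) (by omega) (by omega)
    have h5 : label w (i, j + 1) ≤ _ := label_mono w (show i ≤ i + 1 by omega) le_rfl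
    have h6 := diagPos_le_card (blankTiles w) (i, j + 1)
    have h8 := label_le_snd (w := w) (a := i) h1.2.le
    have h7 : diag (i, j + 1) = diag (x, y) := by simp only [diag]; omega
    rw [h7] at h6
    simp only
    omega
  have left : ∀ x y : ℕ, (x, y + 1) ∈ (blankTiles w).image (shift w) →
      (x, y) ∈ (blankTiles w).image (shift w) := by
    intro x y h
    obtain ⟨⟨i, j⟩, hb, he⟩ := mem_image.1 h
    rw [hw.mem_image_shift]
    have h1 := blank_lt hb
    have h2 := hw.nwChain_of_blank hb
    have h3 := label_blank hb
    simp only [shift, Prod.mk.injEq] at he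
    have h4 := diagPos_add_label (i + 1) j (h2.mono le_rfl (by omega)) (by omega) (by omega)
    have h5 : label w (i + 1, j) ≤ _ := label_mono w le_rfl (show j ≤ j + 1 by omega)
    have h6 := diagPos_le_card (blankTiles w) (i + 1, j)
    have h8 := label_le_fst (w := w) (c := j) h1.1.le
    have h7 : diag (i + 1, j) = diag (x, y) := by simp only [diag]; omega
    rw [h7] at h6
    simp only
    omega
  rintro ⟨x, y⟩ ⟨x', y'⟩ ⟨hx, hy⟩ h
  obtain ⟨s, rfl⟩ := Nat.exists_eq_add_of_le (show x' ≤ x from hx)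
  obtain ⟨t, rfl⟩ := Nat.exists_eq_add_of_le (show y' ≤ y from hy)
  clear hx hy
  rw [mem_coe] at h ⊢
  induction s with
  | zero =>
    induction t with
    | zero => exact h
    | succ t ih => exact ih (left _ _ h)
  | succ s ih => exact ih (up _ _ h)

theorem IsVexillary.shift_injOn {w : Equiv.Perm (Fin n)} (hw : IsVexillary w) :
    Set.InjOn (shift w) (blankTiles w : Set (ℕ × ℕ)) := by
  intro p hp q hq h
  have h1 := hw.diagPos_blank hp
  have h2 := hw.diagPos_blank hq
  simp only [shift, Prod.mk.injEq] at h
  exact diagPos_inj hp hq (by simp only [diag]; omega) (by omega)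

theorem IsVexillary.diag_shift {w : Equiv.Perm (Fin n)} (hw : IsVexillary w) {p : ℕ × ℕ}
    (h : p ∈ blankTiles w) : diag (shift w p) = diag p := by
  have h1 := hw.diagPos_blank h
  simp only [diag, shift]
  omega

theorem IsVexillary.card_diag_image_shift {w : Equiv.Perm (Fin n)} (hw : IsVexillary w) (d : ℤ) :
    #{p ∈ (blankTiles w).image (shift w) | diag p = d} = #{p ∈ blankTiles w | diag p = d} := by
  rw [filter_image, card_image_of_injOn (hw.shift_injOn.mono fun p hp => (mem_filter.1 hp).1)]
  exact congrArg card (filter_congr fun p hp => by rw [hw.diag_shift hp])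

theorem IsVexillary.isShape_iff {w : Equiv.Perm (Fin n)} (hw : IsVexillary w)
    (lam : YoungDiagram) : IsShape w lam ↔ lam.cells = (blankTiles w).image (shift w) := by
  constructor
  · intro h
    refine Finset.ext fun p => ?_
    rw [mem_young_iff, hw.mem_image_shift, h]
  · intro h d
    rw [h, hw.card_diag_image_shift]

theorem IsVexillary.existsUnique_isShape {w : Equiv.Perm (Fin n)} (hw : IsVexillary w) :
    ∃! lam : YoungDiagram, IsShape w lam := by
  refine ⟨⟨(blankTiles w).image (shift w), hw.isLowerSet_image_shift⟩,
    (hw.isShape_iff _).2 rfl, fun lam h => ?_⟩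
  exact YoungDiagram.ext ((hw.isShape_iff _).1 h)

theorem IsVexillary.tau_eq {w : Equiv.Perm (Fin n)} (hw : IsVexillary w) {lam : YoungDiagram}
    (h : IsShape w lam) (k : ℕ) :
    tau w lam k = {b ∈ blankTiles w | k ≤ label w b}.image (shift w) := by
  have hc := (hw.isShape_iff lam).1 h
  refine Finset.ext fun p => ?_
  simp only [tau, mem_filter, mem_image]
  constructor
  · rintro ⟨hp, q, hq, ⟨hd, he⟩, hk⟩
    rw [diagPos_young lam hp] at he
    have h1 := hw.diagPos_blank hq
    simp only [diag] at hd
    exact ⟨q, ⟨hq, hk⟩, Prod.ext (by simp only [shift]; omega) (by simp only [shift]; omega)⟩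
  · rintro ⟨q, ⟨hq, hk⟩, rfl⟩
    have hp : shift w q ∈ lam.cells := hc ▸ mem_image_of_mem _ hq
    refine ⟨hp, q, hq, ⟨hw.diag_shift hq, ?_⟩, hk⟩
    rw [diagPos_young lam hp]
    have h1 := hw.diagPos_blank hq
    simp only [shift]
    omega

/-! ### Counting dots around a vertex southeast of a given dot -/

/-- The tiles of the Young diagram that come from blank tiles southeast of the dot in row `x`. -/
def seShape (w : Equiv.Perm (Fin n)) (x : Fin n) : Finset (ℕ × ℕ) :=
  {b ∈ blankTiles w | (x : ℕ) < b.1 ∧ (w x : ℕ) < b.2}.image (shift w)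

/-- The number of dots weakly northwest of the dot in row `x`. -/
def downCard (w : Equiv.Perm (Fin n)) (x : Fin n) : ℕ := #{j : Fin n | j ≤ x ∧ w j ≤ w x}

/-- The dots strictly southeast of the dot in row `x`. -/
def upDots (w : Equiv.Perm (Fin n)) (x : Fin n) : Finset (Fin n) := {j | x < j ∧ w x < w j}

/-- The dots below row `x` lying northeast of the vertex `(a, c)`. -/
def neDots (w : Equiv.Perm (Fin n)) (x : Fin n) (a c : ℕ) : Finset (Fin n) :=
  {j | x < j ∧ (j : ℕ) < a ∧ c ≤ (w j : ℕ)}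

/-- The dots right of column `w x` lying southwest of the vertex `(a, c)`. -/
def swDots (w : Equiv.Perm (Fin n)) (x : Fin n) (a c : ℕ) : Finset (Fin n) :=
  {j | a ≤ (j : ℕ) ∧ w x < w j ∧ (w j : ℕ) < c}

/-- Count rows above `a`: those after `x` hold a northeast or a northwest dot, and the chain
condition makes the northwest dots up to row `x` exactly those counted by `downCard w x`. -/
theorem NWChain.card_neDots {w : Equiv.Perm (Fin n)} {a c : ℕ} (h : NWChain w a c) {x : Fin n}
    (hxa : (x : ℕ) < a) (hxc : (w x : ℕ) < c) (ha : a ≤ n) :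
    #(neDots w x a c) + label w (a, c) + (x + 1) = a + downCard w x := by
  have h1 := card_fin_lt (n := n) (a := x + 1) (by omega)
  have h2 := card_fin_lt ha
  rw [← h1]
  conv_rhs => rw [← h2]
  simp only [neDots, label, downCard, card_filter, ← sum_add_distrib]
  refine sum_congr rfl fun j _ => ?_
  have e1 : j < x → (w j : ℕ) < c → w j < w x := fun e e' => h j x e hxa e' hxc
  have e2 : x < j → (j : ℕ) < a → (w j : ℕ) < c → w x < w j := fun e e' e'' => h x j e e' hxc e''
  rcases lt_trichotomy j x with e | rfl | e
  · have e1 := e1 e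
    split_ifs <;> omega
  · split_ifs <;> omega
  · have e2 := e2 e
    split_ifs <;> omega

theorem NWChain.card_swDots {w : Equiv.Perm (Fin n)} {a c : ℕ} (h : NWChain w a c) {x : Fin n}
    (hxa : (x : ℕ) < a) (hxc : (w x : ℕ) < c) (hc : c ≤ n) :
    #(swDots w x a c) + label w (a, c) + (w x + 1) = c + downCard w x := by
  have h1 := card_fin_lt (n := n) (a := w x + 1) (by omega)
  have h2 := card_fin_lt hc
  rw [← card_perm_lt w (· < (w x : ℕ) + 1)] at h1
  rw [← card_perm_lt w (· < c)] at h2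
  rw [← h1]
  conv_rhs => rw [← h2]
  simp only [swDots, label, downCard, card_filter, ← sum_add_distrib]
  refine sum_congr rfl fun j _ => ?_
  have e1 : j < x → (w j : ℕ) < c → w j < w x := fun e e' => h j x e hxa e' hxc
  have e2 : x < j → (j : ℕ) < a → (w j : ℕ) < c → w x < w j := fun e e' e'' => h x j e e' hxc e''
  rcases lt_trichotomy j x with e | rfl | e
  · have e1 := e1 e
    split_ifs <;> omega
  · split_ifs <;> omega
  · have e2 := e2 e
    split_ifs <;> omega

theorem downCard_le_fst (w : Equiv.Perm (Fin n)) (x : Fin n) : downCard w x ≤ x + 1 := by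
  rw [← card_fin_lt (n := n) (a := x + 1) (by omega)]
  refine card_le_card fun j => ?_
  simp only [mem_filter, mem_univ, true_and]
  omega

theorem downCard_le_snd (w : Equiv.Perm (Fin n)) (x : Fin n) : downCard w x ≤ w x + 1 := by
  rw [← card_fin_lt (n := n) (a := w x + 1) (by omega), ← card_perm_lt w (· < (w x : ℕ) + 1)]
  refine card_le_card fun j => ?_
  simp only [mem_filter, mem_univ, true_and]
  omega

/-- The two counts are the coordinates of `t`, numbered from one, relative to the corner `(x + 1 -
downCard w x, w x + 1 - downCard w x)`. -/
theorem IsVexillary.exists_of_mem_seShape {w : Equiv.Perm (Fin n)} (hw : IsVexillary w)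
    {x : Fin n} {t : ℕ × ℕ} (ht : t ∈ seShape w x) :
    ∃ a c : ℕ, (a, c) ∈ blankTiles w ∧ (x : ℕ) < a ∧ (w x : ℕ) < c ∧
      t.1 + label w (a, c) = a ∧ t.2 + label w (a, c) = c ∧
      #(neDots w x (a + 1) (c + 1)) + x = t.1 + downCard w x ∧
      #(swDots w x (a + 1) (c + 1)) + w x = t.2 + downCard w x := by
  simp only [seShape, mem_image, mem_filter] at ht
  obtain ⟨⟨a, c⟩, ⟨hb, hxa, hxc⟩, rfl⟩ := ht
  have h1 := blank_lt hb
  have h2 := hw.nwChain_of_blank hb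
  have h3 := h2.card_neDots (x := x) (by simp only at hxa; omega) (by simp only at hxc; omega) h1.1
  have h4 := h2.card_swDots (x := x) (by simp only at hxa; omega) (by simp only at hxc; omega) h1.2
  have h5 := hw.diagPos_blank hb
  rw [label_blank hb] at h3 h4
  simp only [shift] at *
  exact ⟨a, c, hb, hxa, hxc, by omega, by omega, by omega, by omega⟩

/-! ### Chains against paths: the upper bound on paths -/

theorem IsAntidiagonalPath.mono {S T : Finset (ℕ × ℕ)} (hT : IsAntidiagonalPath T) (h : S ⊆ T) :
    IsAntidiagonalPath S := fun p hp q hq => hT p (h hp) q (h hq)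

theorem IsAntidiagonalPath.card_le_fst {T : Finset (ℕ × ℕ)} (hT : IsAntidiagonalPath T) {l u : ℕ}
    (h : ∀ p ∈ T, l ≤ p.1 ∧ p.1 < u) : #T ≤ u - l := by
  rw [← Nat.card_Ico]
  refine card_le_card_of_injOn Prod.fst (fun p hp => by simpa using h p hp) fun p hp q hq he => ?_
  by_contra hne
  have := hT p hp q hq hne
  omega

theorem IsAntidiagonalPath.card_le_snd {T : Finset (ℕ × ℕ)} (hT : IsAntidiagonalPath T) {l u : ℕ}
    (h : ∀ p ∈ T, l ≤ p.2 ∧ p.2 < u) : #T ≤ u - l := by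
  rw [← Nat.card_Ico]
  refine card_le_card_of_injOn Prod.snd (fun p hp => by simpa using h p hp) fun p hp q hq he => ?_
  by_contra hne
  have := hT p hp q hq hne
  omega

/-- No chain meets both the northeast and the southwest dots of a vertex. The path is cut at the
first tile whose northeast dots meet `C`: the tiles above it are paid for by northeast dots, the
others by southwest dots, all outside `C`. -/
theorem IsVexillary.card_chain_add_card_path_le {w : Equiv.Perm (Fin n)} (hw : IsVexillary w)
    {x : Fin n} {C : Finset (Fin n)} (hC : C ⊆ upDots w x)
    (hmono : StrictMonoOn w (C : Set (Fin n))) {T : Finset (ℕ × ℕ)} (hT : IsAntidiagonalPath T)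
    (hTS : T ⊆ seShape w x) : #C + #T ≤ #(upDots w x) := by
  classical
  have hall : ∀ t : ℕ × ℕ, ∃ a c : ℕ, t ∈ T → (a, c) ∈ blankTiles w ∧ (x : ℕ) < a ∧ (w x : ℕ) < c ∧
      t.1 + label w (a, c) = a ∧ t.2 + label w (a, c) = c ∧
      #(neDots w x (a + 1) (c + 1)) + x = t.1 + downCard w x ∧
      #(swDots w x (a + 1) (c + 1)) + w x = t.2 + downCard w x := by
    intro t
    by_cases ht : t ∈ T
    · obtain ⟨a, c, h⟩ := hw.exists_of_mem_seShape (hTS ht)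
      exact ⟨a, c, fun _ => h⟩
    · exact ⟨0, 0, fun h => absurd h ht⟩
  choose a c hac using hall
  have hsub : ∀ t ∈ T, neDots w x (a t + 1) (c t + 1) ⊆ upDots w x ∧
      swDots w x (a t + 1) (c t + 1) ⊆ upDots w x := by
    intro t ht
    have h := hac t ht
    constructor
    · intro j
      simp only [neDots, upDots, mem_filter, mem_univ, true_and]
      omega
    · intro j
      simp only [swDots, upDots, mem_filter, mem_univ, true_and]
      omega
  have hlow : ∀ t ∈ T, (x : ℕ) + 1 - downCard w x ≤ t.1 ∧ (w x : ℕ) + 1 - downCard w x ≤ t.2 := by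
    intro t ht
    have h := hac t ht
    have h1 : 0 < #(neDots w x (a t + 1) (c t + 1)) := by
      obtain ⟨i, e, h1, h2, h3, h4⟩ := (mem_blankTiles w _ _).1 h.1
      refine card_pos.2 ⟨i, ?_⟩
      simp only [neDots, mem_filter, mem_univ, true_and]
      omega
    have h2 : 0 < #(swDots w x (a t + 1) (c t + 1)) := by
      obtain ⟨i, e, h1, h2, h3, h4⟩ := (mem_blankTiles w _ _).1 h.1
      refine card_pos.2 ⟨e, ?_⟩
      simp only [swDots, mem_filter, mem_univ, true_and]
      omega
    omega
  -- The northeast dots of the lowest tile of `T'` suffice, since their number is its row relative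
  -- to the corner.
  have hne : ∀ T' ⊆ T, (∀ t ∈ T', Disjoint C (neDots w x (a t + 1) (c t + 1))) →
      ∃ X ⊆ upDots w x, Disjoint C X ∧ #T' ≤ #X ∧
        ∀ j ∈ X, ∃ t ∈ T', j ∈ neDots w x (a t + 1) (c t + 1) := by
    intro T' hT' hd
    rcases T'.eq_empty_or_nonempty with rfl | hnon
    · exact ⟨∅, by simp, by simp, by simp, by simp⟩
    · obtain ⟨t, ht, hmax⟩ := exists_max_image T' Prod.fst hnon
      refine ⟨_, (hsub t (hT' ht)).1, hd t ht, ?_, fun j hj => ⟨t, ht, hj⟩⟩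
      have h1 := (hT.mono hT').card_le_fst (l := x + 1 - downCard w x) (u := t.1 + 1)
        fun p hp => ⟨(hlow p (hT' hp)).1, Nat.lt_succ_of_le (hmax p hp)⟩
      have h2 := hac t (hT' ht)
      have h3 := downCard_le_fst w x
      omega
  rcases (T.filter fun t => ¬ Disjoint C (neDots w x (a t + 1) (c t + 1))).eq_empty_or_nonempty
    with hF | hF
  · rw [filter_eq_empty_iff] at hF
    obtain ⟨X, h1, h2, h3, -⟩ := hne T subset_rfl fun t ht => not_not.1 (hF ht)
    calc #C + #T ≤ #C + #X := by omega
      _ = #(C ∪ X) := (card_union_of_disjoint h2).symm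
      _ ≤ _ := card_le_card (union_subset hC h1)
  · obtain ⟨t, ht, hmin⟩ := exists_min_image _ Prod.fst hF
    obtain ⟨ht, htC⟩ := mem_filter.1 ht
    obtain ⟨X, h1, h2, h3, h4⟩ := hne (T.filter fun s => s.1 < t.1) (filter_subset _ _) (by
      intro s hs
      obtain ⟨hs, hst⟩ := mem_filter.1 hs
      by_contra hcon
      have := hmin s (mem_filter.2 ⟨hs, hcon⟩)
      omega)
    have hact := hac t ht
    set Y := swDots w x (a t + 1) (c t + 1) with hY
    have hCY : Disjoint C Y := by
      obtain ⟨j, hjC, hj⟩ := not_disjoint_iff.1 htC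
      rw [disjoint_left]
      intro l hl hlY
      simp only [hY, swDots, neDots, mem_filter, mem_univ, true_and] at hj hlY
      have := hmono hjC hl (by omega)
      omega
    have hXY : Disjoint X Y := by
      rw [disjoint_left]
      intro j hj hjY
      obtain ⟨s, hs, hjs⟩ := h4 j hj
      obtain ⟨hs, hst⟩ := mem_filter.1 hs
      have h5 := hT s hs t ht (by rintro rfl; omega)
      have h6 := hac s hs
      -- A common dot would put the blank tile of `s` strictly southwest of that of `t`, while `s`
      -- is strictly northeast of `t`; the two coordinates then order the labels oppositely.
      simp only [hY, swDots, neDots, mem_filter, mem_univ, true_and] at hjs hjY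
      omega
    have hTY : #(T.filter fun s => ¬ s.1 < t.1) ≤ #Y := by
      have h5 := (hT.mono (filter_subset (fun s => ¬ s.1 < t.1) T)).card_le_snd
        (l := w x + 1 - downCard w x) (u := t.2 + 1) (by
          intro p hp
          obtain ⟨hp, hpt⟩ := mem_filter.1 hp
          refine ⟨(hlow p hp).2, ?_⟩
          by_cases hpt' : p = t
          · subst hpt'; omega
          · have := hT p hp t ht hpt'
            omega)
      have h6 := downCard_le_snd w x
      omega
    have hsum := card_filter_add_card_filter_not (s := T) (fun s => s.1 < t.1)
    calc #C + #T ≤ #C + #X + #Y := by omega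
      _ = #((C ∪ X) ∪ Y) := by
        rw [card_union_of_disjoint (disjoint_union_left.2 ⟨hCY, hXY⟩), card_union_of_disjoint h2]
      _ ≤ _ := card_le_card (union_subset (union_subset hC h1) (hsub t ht).2)

/-! ### Chains against paths: a long path exists -/

theorem NWChain.le_card_neDots_add {w : Equiv.Perm (Fin n)} {x : Fin n} {a c m : ℕ}
    (h : NWChain w a c) (h' : SEChain w a c)
    (hm : ∀ C ⊆ upDots w x, StrictMonoOn w (C : Set (Fin n)) → #C + m ≤ #(upDots w x)) :
    m ≤ #(neDots w x a c) + #(swDots w x a c) := by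
  classical
  -- With both quadrants increasing, the northwest and southeast dots join into a single chain.
  set C : Finset (Fin n) := (upDots w x).filter fun j =>
    ((j : ℕ) < a ∧ (w j : ℕ) < c) ∨ (a ≤ (j : ℕ) ∧ c ≤ (w j : ℕ)) with hC
  have h1 := hm C (filter_subset _ _) (by
    intro j hj l hl hjl
    simp only [hC, coe_filter, Set.mem_ofPred_eq] at hj hl
    rcases hj.2 with h1 | h1 <;> rcases hl.2 with h2 | h2
    · exact h j l hjl h2.1 h1.2 h2.2
    · omega
    · omega
    · exact h' j l hjl h1.1 h1.2 h2.2)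
  have h2 : upDots w x ⊆ C ∪ (neDots w x a c ∪ swDots w x a c) := by
    intro j hj
    simp only [mem_union, hC, mem_filter, hj, true_and, neDots, swDots, mem_univ]
    simp only [upDots, mem_filter, mem_univ, true_and] at hj
    omega
  have h3 := (card_le_card h2).trans (card_union_le _ _)
  have h4 := card_union_le (neDots w x a c) (swDots w x a c)
  omega

theorem card_fin_Ico_le (a b : ℕ) : #{j : Fin n | a ≤ (j : ℕ) ∧ (j : ℕ) < b} ≤ b - a := by
  rw [← Nat.card_Ico]
  exact card_le_card_of_injOn (fun j : Fin n => (j : ℕ)) (fun j hj => by simpa using hj)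
    (fun i _ j _ h => Fin.ext h)

/-- If the tile were missing, a walk down its diagonal would keep the northeast count at most `s`
and the southwest count at most `t`. Their sum is below `m`, so the southeast quadrant never becomes
increasing and the walk never leaves the finite grid. -/
theorem IsVexillary.mem_seShape_of_add {w : Equiv.Perm (Fin n)} (hw : IsVexillary w) {x : Fin n}
    {m : ℕ} (hm : ∀ C ⊆ upDots w x, StrictMonoOn w (C : Set (Fin n)) → #C + m ≤ #(upDots w x))
    {s t : ℕ} (hst : s + t + 1 = m) :
    (x + 1 - downCard w x + s, w x + 1 - downCard w x + t) ∈ seShape w x := by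
  classical
  by_contra hnot
  -- `(x + 1 + α, w x + 1 + β)` is the first vertex strictly southeast of the dot on the diagonal of
  -- the missing tile.
  obtain ⟨α, β, hαβ, hα0, hle⟩ :
      ∃ α β : ℕ, α + t = β + s ∧ (α = 0 ∨ β = 0) ∧ α ≤ s ∧ β ≤ t := by
    rcases le_total s t with h | h
    · exact ⟨0, t - s, by omega, by omega, by omega, by omega⟩
    · exact ⟨s - t, 0, by omega, by omega, by omega, by omega⟩
  have hk1 := downCard_le_fst w x
  have hk2 := downCard_le_snd w x
  have hstart : ¬ SEChain w (x + 1 + α) (w x + 1 + β) := by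
    intro hse
    -- Discarding the skipped rows and columns costs at most `α + β ≤ s + t < m` dots.
    have h1 := hm ((upDots w x).filter fun j : Fin n => (x : ℕ) + 1 + α ≤ j ∧ (w x : ℕ) + 1 + β ≤ w j)
      (filter_subset _ _) (by
        intro j hj l hl hjl
        simp only [coe_filter, Set.mem_ofPred_eq] at hj hl
        exact hse j l hjl hj.2.1 hj.2.2 hl.2.2)
    have h2 : upDots w x ⊆ (upDots w x).filter (fun j : Fin n =>
        (x : ℕ) + 1 + α ≤ j ∧ (w x : ℕ) + 1 + β ≤ w j) ∪
        (({j : Fin n | (x : ℕ) + 1 ≤ j ∧ (j : ℕ) < x + 1 + α} : Finset (Fin n)) ∪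
        ({j : Fin n | (w x : ℕ) + 1 ≤ w j ∧ (w j : ℕ) < w x + 1 + β} : Finset (Fin n))) := by
      intro j hj
      simp only [mem_union, mem_filter, hj, true_and, mem_univ]
      simp only [upDots, mem_filter, mem_univ, true_and] at hj
      omega
    have h3 := (card_le_card h2).trans (card_union_le _ _)
    have h4 := card_union_le ({j : Fin n | (x : ℕ) + 1 ≤ j ∧ (j : ℕ) < x + 1 + α} : Finset (Fin n))
      ({j : Fin n | (w x : ℕ) + 1 ≤ w j ∧ (w j : ℕ) < w x + 1 + β} : Finset (Fin n))
    have h5 := card_fin_Ico_le (n := n) (x + 1) (x + 1 + α)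
    have h6 := card_fin_Ico_le (n := n) (w x + 1) (w x + 1 + β)
    rw [← card_perm_lt w (fun j => (w x : ℕ) + 1 ≤ j ∧ j < (w x : ℕ) + 1 + β)] at h6
    omega
  have hin : ∀ a c : ℕ, ¬ SEChain w a c → a < n ∧ c < n := by
    intro a c h
    simp only [SEChain] at h
    push Not at h
    obtain ⟨k, l, -, h1, h2, -⟩ := h
    omega
  have hwalk : ∀ e : ℕ, NWChain w (x + 1 + α + e) (w x + 1 + β + e) ∧ x + 1 + α + e < n ∧
      w x + 1 + β + e < n ∧ ¬ SEChain w (x + 1 + α + e) (w x + 1 + β + e) ∧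
      α + e + downCard w x ≤ label w (x + 1 + α + e, w x + 1 + β + e) + s := by
    have hse : ∀ e, NWChain w (x + 1 + α + e) (w x + 1 + β + e) → x + 1 + α + e ≤ n →
        w x + 1 + β + e ≤ n →
        α + e + downCard w x ≤ label w (x + 1 + α + e, w x + 1 + β + e) + s →
        ¬ SEChain w (x + 1 + α + e) (w x + 1 + β + e) := by
      intro e h1 h2 h3 h4 h5
      have h6 := h1.le_card_neDots_add h5 hm
      have h7 := h1.card_neDots (x := x) (by omega) (by omega) h2
      have h8 := h1.card_swDots (x := x) (by omega) (by omega) h3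
      omega
    intro e
    induction e with
    | zero =>
      have h1 := (hw.nwChain_or_seChain _ _).resolve_right hstart
      have h2 := hin _ _ hstart
      refine ⟨h1, h2.1, h2.2, hstart, ?_⟩
      have h3 := h1.card_neDots (x := x) (by omega) (by omega) h2.1.le
      have h4 : #(neDots w x (x + 1 + α) (w x + 1 + β)) ≤ α := by
        refine le_trans (card_le_card fun j => ?_) ((card_fin_Ico_le (x + 1) (x + 1 + α)).trans
          (by omega))
        simp only [neDots, mem_filter, mem_univ, true_and]
        omega
      simp only [add_zero]
      omega
    | succ e ih =>
      obtain ⟨h1, h2, h3, h4, h5⟩ := ih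
      have h6 : NWChain w (x + 1 + α + (e + 1)) (w x + 1 + β + (e + 1)) := by
        by_contra hcon
        exact h4 (hw.seChain_of_not_nwChain_succ h1 hcon)
      have h7 : α + (e + 1) + downCard w x ≤
          label w (x + 1 + α + (e + 1), w x + 1 + β + (e + 1)) + s := by
        by_cases hb : (x + 1 + α + e, w x + 1 + β + e) ∈ blankTiles w
        · have h8 := label_blank hb
          simp only [add_assoc] at h8 ⊢
          rw [h8]
          by_contra hcon
          -- Only a blank tile raises the counts; raising the northeast count beyond `s` would make
          -- this blank tile shift to the missing one.
          refine hnot (mem_image.2 ⟨_, mem_filter.2 ⟨hb, by simp only; omega, by simp only; omega⟩, ?_⟩)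
          have h9 := hw.diagPos_blank hb
          simp only [add_assoc] at h5 h9 ⊢
          simp only [shift, Prod.mk.injEq]
          omega
        · have h8 := label_of_not_blank h2 h3 h6 hb
          simp only [add_assoc] at h8 h5 ⊢
          omega
      have h8 := hse (e + 1) h6 (by omega) (by omega) h7
      have h9 := hin _ _ h8
      exact ⟨h6, h9.1, h9.2, h8, h7⟩
  have := hwalk n
  omega

/-! ### Longest antidiagonal paths and separated unions -/

theorem card_le_rhoA {S T : Finset (ℕ × ℕ)} (hTS : T ⊆ S) (hT : IsAntidiagonalPath T) :
    #T ≤ rhoA S := by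
  classical
  unfold rhoA
  exact le_sup (f := card) (mem_filter.2 ⟨mem_powerset.2 hTS, hT⟩)

theorem exists_card_eq_rhoA (S : Finset (ℕ × ℕ)) :
    ∃ T ⊆ S, IsAntidiagonalPath T ∧ #T = rhoA S := by
  classical
  unfold rhoA
  obtain ⟨T, hT, he⟩ := exists_mem_eq_sup (S.powerset.filter IsAntidiagonalPath)
    ⟨∅, by simp [IsAntidiagonalPath]⟩ card
  rw [mem_filter, mem_powerset] at hT
  exact ⟨T, hT.1, hT.2, he.symm⟩

theorem rhoA_biUnion {ι : Type*} (I : Finset ι) (S : ι → Finset (ℕ × ℕ))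
    (h : ∀ i ∈ I, ∀ j ∈ I, i ≠ j → ∀ p ∈ S i, ∀ q ∈ S j,
      (q.1 < p.1 ∧ p.2 < q.2) ∨ (p.1 < q.1 ∧ q.2 < p.2)) :
    rhoA (I.biUnion S) = ∑ i ∈ I, rhoA (S i) := by
  classical
  apply le_antisymm
  · obtain ⟨T, hTS, hT, he⟩ := exists_card_eq_rhoA (I.biUnion S)
    rw [← he]
    have h1 : T ⊆ I.biUnion fun i => T ∩ S i := by
      rw [← inter_biUnion]
      exact subset_inter subset_rfl hTS
    refine (card_le_card h1).trans (card_biUnion_le.trans (sum_le_sum fun i _ => ?_))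
    exact card_le_rhoA inter_subset_right (hT.mono inter_subset_left)
  · choose T hTS hT he using fun i => exists_card_eq_rhoA (S i)
    simp only [← he]
    rw [← card_biUnion]
    · refine card_le_rhoA (biUnion_mono fun i _ => hTS i) ?_
      intro p hp q hq hpq
      obtain ⟨i, hi, hp⟩ := mem_biUnion.1 hp
      obtain ⟨j, hj, hq⟩ := mem_biUnion.1 hq
      by_cases hij : i = j
      · subst hij
        exact hT i p hp q hq hpq
      · exact h i hi j hj hij p (hTS i hp) q (hTS j hq)
    · intro i hi j hj hij
      refine disjoint_left.2 fun p hp hq => ?_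
      have := h i hi j hj hij p (hTS i hp) p (hTS j hq)
      omega

/-! ### The codes and the min-max equality -/

theorem card_Ioi_eq (w : Equiv.Perm (Fin n)) (x : Fin n) :
    #(Ioi x) = lehmer w x + #(upDots w x) := by
  classical
  unfold lehmer upDots
  rw [← card_union_of_disjoint]
  · congr 1
    ext j
    simp only [mem_Ioi, mem_union, mem_filter, mem_univ, true_and]
    have : x < j → w j ≠ w x := fun h e => by have := w.injective e; omega
    omega
  · rw [disjoint_filter]
    intro j _ h1 h2
    omega

theorem rajchgot_spec (w : Equiv.Perm (Fin n)) (x : Fin n) :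
    ∃ R : Finset (Fin n), R ⊆ Ioi x ∧ #R = rajchgot w x ∧
      StrictMonoOn w (↑(Ici x \ R) : Set (Fin n)) := by
  refine Nat.sInf_mem (s := {m : ℕ | ∃ R : Finset (Fin n), R ⊆ Ioi x ∧ #R = m ∧
    StrictMonoOn w (↑(Ici x \ R) : Set (Fin n))}) ⟨_, Ioi x, subset_rfl, rfl, ?_⟩
  intro i hi j hj hij
  simp only [coe_sdiff, coe_Ici, coe_Ioi, Set.mem_sdiff, Set.mem_Ici, Set.mem_Ioi] at hi hj
  omega

theorem rajchgot_add_card_le (w : Equiv.Perm (Fin n)) (x : Fin n) {C : Finset (Fin n)}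
    (hC : C ⊆ upDots w x) (hmono : StrictMonoOn w (C : Set (Fin n))) :
    #C + rajchgot w x ≤ #(Ioi x) := by
  classical
  have hsub : C ⊆ Ioi x := fun j hj => by
    have := hC hj
    simp only [upDots, mem_filter, mem_univ, true_and] at this
    exact mem_Ioi.2 this.1
  have h1 : rajchgot w x ≤ #(Ioi x \ C) := by
    refine Nat.sInf_le ⟨_, sdiff_subset, rfl, ?_⟩
    have key : ∀ j ∈ Ici x \ (Ioi x \ C), j = x ∨ (j ∈ C ∧ w x < w j) := by
      intro j hj
      simp only [mem_sdiff, mem_Ici, mem_Ioi, not_and, not_not] at hj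
      rcases eq_or_lt_of_le hj.1 with h | h
      · exact Or.inl h.symm
      · have := hC (hj.2 h)
        simp only [upDots, mem_filter, mem_univ, true_and] at this
        exact Or.inr ⟨hj.2 h, this.2⟩
    intro i hi j hj hij
    have hi' := hi
    simp only [mem_coe] at hi hj
    have hxi : x ≤ i := mem_Ici.1 (mem_sdiff.1 hi).1
    rcases key i hi with rfl | h1 <;> rcases key j hj with rfl | h2
    · omega
    · exact h2.2
    · omega
    · exact hmono h1.1 h2.1 hij
  rw [card_sdiff_of_subset hsub] at h1
  have := card_le_card hsub
  omega

theorem IsVexillary.nwChain_of_mem_seShape {w : Equiv.Perm (Fin n)} (hw : IsVexillary w) {x : Fin n}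
    {t : ℕ × ℕ} (ht : t ∈ seShape w x) : NWChain w (x + 1) (w x + 1) := by
  obtain ⟨a, c, hb, h1, h2, -⟩ := hw.exists_of_mem_seShape ht
  exact (hw.nwChain_of_blank hb).mono (by omega) (by omega)

theorem IsVexillary.le_rhoA_seShape {w : Equiv.Perm (Fin n)} (hw : IsVexillary w) {x : Fin n}
    {m : ℕ} (hm : ∀ C ⊆ upDots w x, StrictMonoOn w (C : Set (Fin n)) → #C + m ≤ #(upDots w x)) :
    m ≤ rhoA (seShape w x) := by
  classical
  have hinj : Function.Injective fun s : ℕ =>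
      (x + 1 - downCard w x + s, w x + 1 - downCard w x + (m - 1 - s)) := by
    intro s t h
    simp only [Prod.mk.injEq] at h
    omega
  rw [← card_range m, ← card_image_of_injective _ hinj]
  apply card_le_rhoA
  · intro p hp
    obtain ⟨s, hs, rfl⟩ := mem_image.1 hp
    rw [mem_range] at hs
    exact hw.mem_seShape_of_add hm (by omega)
  · intro p hp q hq hpq
    obtain ⟨s, hs, rfl⟩ := mem_image.1 hp
    obtain ⟨t, ht, rfl⟩ := mem_image.1 hq
    rw [mem_range] at hs ht
    have : s ≠ t := fun h => hpq (by rw [h])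
    simp only
    omega

theorem IsVexillary.rajchgot_eq {w : Equiv.Perm (Fin n)} (hw : IsVexillary w) (x : Fin n) :
    rajchgot w x = lehmer w x + rhoA (seShape w x) := by
  classical
  have hI := card_Ioi_eq w x
  have hle : lehmer w x + rhoA (seShape w x) ≤ rajchgot w x := by
    obtain ⟨R, hR, hRc, hmono⟩ := rajchgot_spec w x
    obtain ⟨T, hTS, hT, he⟩ := exists_card_eq_rhoA (seShape w x)
    have hC : Ioi x \ R ⊆ upDots w x := by
      intro j hj
      obtain ⟨h1, h2⟩ := mem_sdiff.1 hj
      simp only [upDots, mem_filter, mem_univ, true_and]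
      refine ⟨mem_Ioi.1 h1, hmono ?_ ?_ (mem_Ioi.1 h1)⟩
      · exact mem_coe.2 (mem_sdiff.2 ⟨mem_Ici.2 le_rfl, fun h => by simpa using hR h⟩)
      · exact mem_coe.2 (mem_sdiff.2 ⟨mem_Ici.2 (mem_Ioi.1 h1).le, h2⟩)
    have h1 := hw.card_chain_add_card_path_le hC (hmono.mono (coe_subset.2
      (sdiff_subset_sdiff Ioi_subset_Ici_self subset_rfl))) hT hTS
    rw [card_sdiff_of_subset hR] at h1
    have h2 := card_le_card hR
    omega
  obtain ⟨m, hm⟩ := Nat.exists_eq_add_of_le (show lehmer w x ≤ rajchgot w x by omega)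
  have h3 : m ≤ rhoA (seShape w x) := hw.le_rhoA_seShape fun C hC hmono => by
    have := rajchgot_add_card_le w x hC hmono
    omega
  omega

/-! ### Rank and the decomposition of `τ_k` -/

theorem NWChain.pipeRank_eq {w : Equiv.Perm (Fin n)} {x : Fin n}
    (h : NWChain w (x + 1) (w x + 1)) : pipeRank w (w x) = downCard w x := by
  classical
  unfold pipeRank downCard
  rw [Equiv.symm_apply_apply]
  apply le_antisymm
  · exact Finset.sup_le fun T hT => card_le_card (mem_powerset.1 (mem_filter.1 hT).1)
  · refine le_sup (f := card) (mem_filter.2 ⟨mem_powerset.2 subset_rfl, ?_⟩)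
    intro i hi j hj hij
    simp only [coe_filter, Set.mem_ofPred_eq, mem_univ, true_and] at hi hj
    exact h i j hij (by omega) (by omega) (by omega)

/-- The dots northwest of a blank tile form a chain, along which `downCard` takes the values `1, 2,
…` up to the label. -/
theorem IsVexillary.exists_downCard_eq {w : Equiv.Perm (Fin n)} (hw : IsVexillary w) {a c k : ℕ}
    (hb : (a, c) ∈ blankTiles w) (hk : 1 ≤ k) (hkl : k ≤ label w (a, c)) :
    ∃ x : Fin n, (x : ℕ) < a ∧ (w x : ℕ) < c ∧ downCard w x = k := by
  classical
  have hch := hw.nwChain_of_blank hb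
  set D : Finset (Fin n) := {j : Fin n | (j : ℕ) < a ∧ (w j : ℕ) < c} with hD
  have hDl : #D = label w (a, c) := rfl
  have hmono : ∀ i ∈ D, ∀ j ∈ D, i < j → downCard w i < downCard w j := by
    intro i hi j hj hij
    simp only [hD, mem_filter, mem_univ, true_and] at hi hj
    have hw' := hch i j hij (by omega) (by omega) (by omega)
    refine card_lt_card ⟨fun l => ?_, fun hs => ?_⟩
    · simp only [mem_filter, mem_univ, true_and]; omega
    · have := hs (show j ∈ _ by simp)
      simp only [mem_filter, mem_univ, true_and] at this
      omega
  have hinj : Set.InjOn (downCard w) (D : Set (Fin n)) := by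
    intro i hi j hj he
    rcases lt_trichotomy i j with h | h | h
    · have := hmono i hi j hj h; omega
    · exact h
    · have := hmono j hj i hi h; omega
  have hsub : D.image (downCard w) ⊆ Icc 1 #D := by
    intro m hm
    obtain ⟨j, hj, rfl⟩ := mem_image.1 hm
    refine mem_Icc.2 ⟨card_pos.2 ⟨j, by simp⟩, card_le_card fun l => ?_⟩
    simp only [hD, mem_filter, mem_univ, true_and] at hj ⊢
    omega
  have heq := eq_of_subset_of_card_le hsub (by rw [Nat.card_Icc, card_image_of_injOn hinj]; omega)
  have : k ∈ D.image (downCard w) := heq ▸ mem_Icc.2 ⟨hk, hkl⟩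
  obtain ⟨x, hx, rfl⟩ := mem_image.1 this
  simp only [hD, mem_filter, mem_univ, true_and] at hx
  exact ⟨x, hx.1, hx.2, rfl⟩

theorem downCard_le_label {w : Equiv.Perm (Fin n)} {a c : ℕ} {x : Fin n} (hxa : (x : ℕ) < a)
    (hxc : (w x : ℕ) < c) : downCard w x ≤ label w (a, c) :=
  card_le_card fun j => by
    simp only [mem_filter, mem_univ, true_and]
    omega

theorem IsVexillary.tau_eq_biUnion {w : Equiv.Perm (Fin n)} (hw : IsVexillary w)
    {lam : YoungDiagram} (h : IsShape w lam) {k : ℕ} (hk : 1 ≤ k) :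
    tau w lam k = ({i : Fin n | pipeRank w i = k} : Finset (Fin n)).biUnion
      fun i => seShape w (w.symm i) := by
  rw [hw.tau_eq h]
  refine Finset.ext fun p => ?_
  simp only [mem_image, mem_biUnion, mem_filter, mem_univ, true_and]
  constructor
  · rintro ⟨⟨a, c⟩, ⟨hb, hkl⟩, rfl⟩
    obtain ⟨x, hxa, hxc, rfl⟩ := hw.exists_downCard_eq hb hk hkl
    have hch := (hw.nwChain_of_blank hb).mono (show (x : ℕ) + 1 ≤ a + 1 by omega)
      (show (w x : ℕ) + 1 ≤ c + 1 by omega)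
    refine ⟨w x, hch.pipeRank_eq, mem_image.2 ⟨(a, c), mem_filter.2 ⟨hb, ?_⟩, rfl⟩⟩
    rw [Equiv.symm_apply_apply]
    exact ⟨hxa, hxc⟩
  · rintro ⟨i, rfl, hp⟩
    obtain ⟨x, rfl⟩ := w.surjective i
    rw [Equiv.symm_apply_apply] at hp
    rw [(hw.nwChain_of_mem_seShape hp).pipeRank_eq]
    obtain ⟨⟨a, c⟩, hb, rfl⟩ := mem_image.1 hp
    obtain ⟨hb, hxa, hxc⟩ := mem_filter.1 hb
    exact ⟨(a, c), ⟨hb, downCard_le_label hxa hxc⟩, rfl⟩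

/-- Equal `downCard` makes the two dots a descent, so no blank tile is southeast of both. Labels at
least `downCard` bound `p.1` and `q.2` above; nonempty `neDots` and `swDots` bound `q.1` and `p.2`
below. -/
theorem IsVexillary.seShape_separated {w : Equiv.Perm (Fin n)} (hw : IsVexillary w) {x y : Fin n}
    (hxy : x < y) (hd : downCard w x = downCard w y) {p q : ℕ × ℕ} (hp : p ∈ seShape w x)
    (hq : q ∈ seShape w y) : p.1 < q.1 ∧ q.2 < p.2 := by
  have hyx : w y < w x := by
    refine lt_of_not_lt_of_ne w hxy fun hlt => ?_
    have : downCard w x < downCard w y := by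
      refine card_lt_card ⟨fun l => ?_, fun hs => ?_⟩
      · simp only [mem_filter, mem_univ, true_and]; omega
      · have := hs (show y ∈ _ by simp)
        simp only [mem_filter, mem_univ, true_and] at this
        omega
    omega
  obtain ⟨a, c, hb, hxa, hxc, h1, h2, h3, h4⟩ := hw.exists_of_mem_seShape hp
  obtain ⟨a', c', hb', hya, hyc, h1', h2', h3', h4'⟩ := hw.exists_of_mem_seShape hq
  have hk := downCard_le_label hxa hxc
  have hk' := downCard_le_label hya hyc
  have hch := hw.nwChain_of_blank hb
  have hch' := hw.nwChain_of_blank hb'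
  have hay : a < y := by
    by_contra hcon
    have := hch x y hxy (by omega) (by omega) (by omega)
    omega
  have hcx : c' < w x := by
    by_contra hcon
    have := hch' x y hxy (by omega) (by omega) (by omega)
    omega
  have hpos : 0 < #(neDots w y (a' + 1) (c' + 1)) ∧ 0 < #(swDots w x (a + 1) (c + 1)) := by
    obtain ⟨i, e, g1, g2, g3, g4⟩ := (mem_blankTiles w _ _).1 hb
    obtain ⟨i', e', g1', g2', g3', g4'⟩ := (mem_blankTiles w _ _).1 hb'
    refine ⟨card_pos.2 ⟨i', ?_⟩, card_pos.2 ⟨e, ?_⟩⟩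
    · simp only [neDots, mem_filter, mem_univ, true_and]
      omega
    · simp only [swDots, mem_filter, mem_univ, true_and]
      omega
  omega

end Vexillary

theorem mainTheorem2 (n : ℕ) (w : Equiv.Perm (Fin n)) (hw : Vexillary.IsVexillary w) :
    (∃! lam : YoungDiagram, Vexillary.IsShape w lam) ∧
    ∀ lam : YoungDiagram, Vexillary.IsShape w lam →
      ∀ k : ℕ, 1 ≤ k →
        (∑ i : Fin n with Vexillary.pipeRank w i = k,
          ((Vexillary.rajchgot w (w.symm i) : ℤ) - (Vexillary.lehmer w (w.symm i) : ℤ))) =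
        (Vexillary.rhoA (Vexillary.tau w lam k) : ℤ) := by
  refine ⟨hw.existsUnique_isShape, fun lam hlam k hk => ?_⟩
  rw [hw.tau_eq_biUnion hlam hk, Vexillary.rhoA_biUnion, Nat.cast_sum]
  · refine Finset.sum_congr rfl fun i _ => ?_
    rw [hw.rajchgot_eq]
    push_cast
    ring
  · intro i hi j hj hij p hp q hq
    obtain ⟨x, rfl⟩ := w.surjective i
    obtain ⟨y, rfl⟩ := w.surjective j
    rw [Equiv.symm_apply_apply] at hp hq
    simp only [Finset.mem_filter, Finset.mem_univ, true_and] at hi hj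
    rw [(hw.nwChain_of_mem_seShape hp).pipeRank_eq] at hi
    rw [(hw.nwChain_of_mem_seShape hq).pipeRank_eq] at hj
    rcases lt_trichotomy x y with h | h | h
    · exact Or.inr (hw.seShape_separated h (hi.trans hj.symm) hp hq)
    · exact absurd (congrArg w h) hij
    · exact Or.inl (hw.seShape_separated h (hj.trans hi.symm) hq hp)
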